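/- Let $1<\zeta\le 2$ and $\varphi(t)=|t|^{\zeta}/\zeta$ (class $C_{II}$). For a real random variable $\eta$ on a probability space $(\Omega,\mathcal F,P)$ put $\tau_\varphi(\eta)=\inf\{a\ge 0: E e^{\lambda\eta}\le e^{\varphi(a\lambda)}\ \text{for all }\lambda\in\mathbb R\}$; $\eta$ is $\varphi$-sub-Gaussian, $\eta\in \mathrm{Sub}_\varphi(\Omega)$, if such an $a$ exists. Let $T>0$, $C\ge 0$, $0<\alpha<1$, and let $X=\{X(t),\ t\in[0,T]\}$ be a separable process with $X(t)\in\mathrm{Sub}_\varphi(\Omega)$ for all $t$ and $$\sup_{|t-s|\le h}\tau_\varphi(X(t)-X(s))\le \sigma(h)=Ch^{\alpha}\qquad (h>0).\tag{2}$$ Let $X(t)=\sum_{k=0}^{\infty}\xi_k a_k(t)$, convergent in mean square for each $t\in[0,T]$, with $\xi_k\in\mathrm{Sub}_\varphi(\Omega)$ and real functions $a_k$ on $[0,T]$, let $X_N(t)=\sum_{k=0}^{N}\xi_k a_k(t)$ be the model of $X$ and let $\Delta_N=X-X_N$. Assume that the $\xi_k$ are independent or, if they are not, that $\Delta_N$ also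 satisfies (2) with the same $\sigma$. Put $$\beta=\sigma\Big(\inf_{s\in[0,T]}\sup_{t\in[0,T]}|t-s|\Big)=C(T/2)^{\alpha},\qquad \gamma_N=\sup_{u\in[0,T]}\tau_\varphi(\Delta_N(u)).$$ Let $0<\gamma_N<\delta$. If $$\nu\ \ge\ 2\exp\left\{-\frac{(\zeta-1)\,\delta^{\frac1{\zeta-1}}(\delta-\gamma_N)^{\frac{\zeta}{\zeta-1}}}{\zeta\left(\gamma_N^{\zeta}(\delta-\gamma_N)+\beta^{\zeta}\gamma_N\right)^{\frac1{\zeta-1}}}\right\}\cdot 2\left(\frac{e\,\delta}{\gamma_N}\right)^{1/\alpha},$$ then $X_N$ approximates $X$ with reliability $1-\nu$ and accuracy $\delta$ in $C(0,T)$, that is, $$P\Big\{\sup_{t\in[0,T]}|X(t)-X_N(t)|>\delta\Big\}\le\nu .$$ -/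

import Mathlib

open MeasureTheory ProbabilityTheory Filter Topology

noncomputable section

/-- The power function `φ(t) = |t|^ζ / ζ`. The class `C_II` consists of these for `1 < ζ ≤ 2`. -/
def powPhi (ζ : ℝ) (t : ℝ) : ℝ := |t| ^ ζ / ζ

/-- The numbers `a ≥ 0` with `E exp(l η) ≤ exp(φ(a l))` for all real `l`; the expectation is
required to be finite. -/
def subPhiBounds {Ω : Type*} [MeasurableSpace Ω] (P : Measure Ω) (φ : ℝ → ℝ) (η : Ω → ℝ) :
    Set ℝ :=
  {a : ℝ | 0 ≤ a ∧ ∀ l : ℝ, Integrable (fun ω => Real.exp (l * η ω)) P ∧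
    ∫ ω, Real.exp (l * η ω) ∂P ≤ Real.exp (φ (a * l))}

/-- `η` is a `φ`-sub-Gaussian random variable. -/
def IsSubPhi {Ω : Type*} [MeasurableSpace Ω] (P : Measure Ω) (φ : ℝ → ℝ) (η : Ω → ℝ) : Prop :=
  Measurable η ∧ (subPhiBounds P φ η).Nonempty

/-- The `φ`-sub-Gaussian standard `τ_φ(η)`. -/
def subPhiStd {Ω : Type*} [MeasurableSpace Ω] (P : Measure Ω) (φ : ℝ → ℝ) (η : Ω → ℝ) : ℝ :=
  sInf (subPhiBounds P φ η)

/-- Separability of a stochastic process: there are a countable dense set `S` and a null event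
outside of which, for every open `U` and every closed `F`, the path has values in `F` on all
of `U` as soon as it has values in `F` on `U ∩ S`. -/
def IsSeparablePaths {Ω : Type*} [MeasurableSpace Ω] {B : Type*} [TopologicalSpace B]
    (P : Measure Ω) (X : B → Ω → ℝ) : Prop :=
  ∃ S : Set B, S.Countable ∧ Dense S ∧
    ∀ᵐ ω ∂P, ∀ U : Set B, IsOpen U → ∀ F : Set ℝ, IsClosed F →
      (∀ t ∈ U ∩ S, X t ω ∈ F) → ∀ t ∈ U, X t ω ∈ F

/-- `sup_{ρ(t,s) ≤ h} τ_φ(X(t) - X(s)) ≤ σ(h)` for all `h > 0`. -/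
def IncrementBound {Ω : Type*} [MeasurableSpace Ω] {B : Type*} [PseudoMetricSpace B]
    (P : Measure Ω) (φ : ℝ → ℝ) (X : B → Ω → ℝ) (σ : ℝ → ℝ) : Prop :=
  ∀ h : ℝ, 0 < h → ∀ t s : B, dist t s ≤ h →
    subPhiStd P φ (fun ω => X t ω - X s ω) ≤ σ h

/-- `β = σ(inf_s sup_t ρ(t,s))`. -/
def radiusBeta (B : Type*) [PseudoMetricSpace B] (σ : ℝ → ℝ) : ℝ :=
  σ (⨅ s : B, ⨆ t : B, dist t s)

/-- `X_N(t) = ∑_{k=0}^N ξ_k a_k(t)`. -/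
def seriesModel {Ω : Type*} {B : Type*} (ξ : ℕ → Ω → ℝ) (a : ℕ → B → ℝ) (N : ℕ) :
    B → Ω → ℝ :=
  fun t ω => ∑ k ∈ Finset.range (N + 1), ξ k ω * a k t

/-- `X(t) = ∑_{k=0}^∞ ξ_k a_k(t)` for every `t`, the series converging in mean square. -/
def IsSeries {Ω : Type*} [MeasurableSpace Ω] {B : Type*} (P : Measure Ω)
    (X : B → Ω → ℝ) (ξ : ℕ → Ω → ℝ) (a : ℕ → B → ℝ) : Prop :=
  ∀ t : B, Tendsto (fun n => eLpNorm (fun ω => X t ω - seriesModel ξ a n t ω) 2 P)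
    atTop (𝓝 0)

/-- The error process `Δ_N(t) = X(t) - X_N(t)`. -/
def modelError {Ω : Type*} {B : Type*} (X Y : B → Ω → ℝ) : B → Ω → ℝ :=
  fun t ω => X t ω - Y t ω

/-- `sup_t τ_φ(X(t))`. -/
def supStd {Ω : Type*} [MeasurableSpace Ω] {B : Type*} (P : Measure Ω) (φ : ℝ → ℝ)
    (X : B → Ω → ℝ) : ℝ :=
  ⨆ t : B, subPhiStd P φ (X t)

/-- `Y` approximates `X` with reliability `1 - ν` and accuracy `δ` uniformly:
`P{sup_t |X(t) - Y(t)| > δ} ≤ ν`. The supremum is taken in `[0, ∞]`. -/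
def ApproximatesUniformly {Ω : Type*} [MeasurableSpace Ω] {B : Type*} (P : Measure Ω)
    (X Y : B → Ω → ℝ) (ν δ : ℝ) : Prop :=
  P.real {ω | ENNReal.ofReal δ < ⨆ t : B, ENNReal.ofReal |modelError X Y t ω|} ≤ ν

end

/-! The core is a single random majorant: for each `l ≥ 0` there are a constant `A` and `H ≥ 0` with
`E H ≤ 1` such that, for each `t`, `exp (l |Δ_N(t)| - A) ≤ H` almost surely (`exists_majorant_Icc`).
Markov's inequality then bounds the probability by `exp (A - l δ)`, and minimising over `l` gives
the stated exponent (`exists_chernoff_parameter`).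

`H` comes from chaining with `p = γ/δ`. The nets are chosen so that the links of level `j ≥ 1` have
standard at most `β p^j`, while level `0` has standard at most `γ`. Weighting level `j` by `w_j =
p^j (1 - p)` and using convexity of `exp` turns the exponential of the sum of links into a weighted
sum of exponentials. The ratio of standard to weight is the same at all levels `j ≥ 1`, so `A` has
closed form.

Two points are needed before chaining. If the `ξ_k` are independent, the increments of `Δ_N` inherit
(2), since removing an independent centred summand cannot increase the exponential moment. And `Δ_N`
inherits from `X` enough separability to replace the supremum by a countable one, although the `a_k`
may be discontinuous (`exists_ae_forall_modelError_mem`). -/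

open MeasureTheory ProbabilityTheory Filter Topology

/-! ### Calculus of φ-sub-Gaussian variables -/

section SubPhi

variable {Ω : Type*} [MeasurableSpace Ω] {P : Measure Ω} {ζ : ℝ}

theorem powPhi_le_powPhi (hζ : 1 < ζ) {x y : ℝ} (h : |x| ≤ |y|) : powPhi ζ x ≤ powPhi ζ y := by
  unfold powPhi
  have := Real.rpow_le_rpow (abs_nonneg x) h (by linarith : (0 : ℝ) ≤ ζ)
  gcongr

theorem mem_subPhiBounds_mono (hζ : 1 < ζ) {η : Ω → ℝ} {a b : ℝ}
    (ha : a ∈ subPhiBounds P (powPhi ζ) η) (hab : a ≤ b) :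
    b ∈ subPhiBounds P (powPhi ζ) η := by
  refine ⟨ha.1.trans hab, fun l => ⟨(ha.2 l).1, (ha.2 l).2.trans ?_⟩⟩
  refine Real.exp_le_exp.2 (powPhi_le_powPhi hζ ?_)
  rw [abs_mul, abs_mul, abs_of_nonneg ha.1, abs_of_nonneg (ha.1.trans hab)]
  gcongr

/-- The infimum defining the standard is attained, because the bound `exp (φ (d l))` is continuous
in `d`. -/
theorem mem_subPhiBounds_of_subPhiStd_le (hζ : 1 < ζ) {η : Ω → ℝ}
    (hne : (subPhiBounds P (powPhi ζ) η).Nonempty) {c : ℝ}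
    (hc : subPhiStd P (powPhi ζ) η ≤ c) : c ∈ subPhiBounds P (powPhi ζ) η := by
  have hgt : ∀ d, c < d → d ∈ subPhiBounds P (powPhi ζ) η := by
    intro d hd
    obtain ⟨a, ha, had⟩ := exists_lt_of_csInf_lt hne (lt_of_le_of_lt hc hd)
    exact mem_subPhiBounds_mono hζ ha had.le
  refine ⟨le_trans (Real.sInf_nonneg fun a ha => ha.1) hc,
    fun l => ⟨((hgt (c + 1) (by linarith)).2 l).1, ?_⟩⟩
  have hcont : Continuous fun d : ℝ => Real.exp (powPhi ζ (d * l)) := by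
    unfold powPhi
    have : Continuous fun d : ℝ => |d * l| ^ ζ :=
      (by fun_prop : Continuous fun d : ℝ => |d * l|).rpow_const
        fun _ => Or.inr (by linarith)
    fun_prop
  have hlim : Tendsto (fun d : ℝ => Real.exp (powPhi ζ (d * l))) (𝓝[>] c)
      (𝓝 (Real.exp (powPhi ζ (c * l)))) := (hcont.tendsto c).mono_left nhdsWithin_le_nhds
  refine ge_of_tendsto hlim ?_
  filter_upwards [self_mem_nhdsWithin] with d hd using ((hgt d hd).2 l).2

theorem mem_subPhiBounds_const_mul {η : Ω → ℝ} {a : ℝ}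
    (ha : a ∈ subPhiBounds P (powPhi ζ) η) (c : ℝ) :
    |c| * a ∈ subPhiBounds P (powPhi ζ) (fun ω => c * η ω) := by
  refine ⟨mul_nonneg (abs_nonneg c) ha.1, fun l => ?_⟩
  have h := ha.2 (l * c)
  simp only [mul_assoc] at h ⊢
  refine ⟨h.1, h.2.trans (le_of_eq ?_)⟩
  congr 1
  simp only [powPhi, abs_mul, abs_abs]
  congr 2
  ring

/-- No independence is needed: `exp` is convex, and the weights `a/(a+b)`, `b/(a+b)` make both
rescaled bounds equal to `exp (φ ((a+b) l))`. -/
theorem mem_subPhiBounds_add {η θ : Ω → ℝ} (hη : Measurable η) (hθ : Measurable θ)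
    {a b : ℝ} (ha0 : 0 < a) (hb0 : 0 < b)
    (ha : a ∈ subPhiBounds P (powPhi ζ) η) (hb : b ∈ subPhiBounds P (powPhi ζ) θ) :
    a + b ∈ subPhiBounds P (powPhi ζ) (fun ω => η ω + θ ω) := by
  refine ⟨by positivity, fun l => ?_⟩
  set u := a / (a + b) with hu
  set v := b / (a + b) with hv
  have hu0 : 0 < u := by positivity
  have hv0 : 0 < v := by positivity
  have huv : u + v = 1 := by rw [hu, hv]; field_simp
  have h1 := ha.2 (l / u)
  have h2 := hb.2 (l / v)
  have e1 : a * (l / u) = (a + b) * l := by rw [hu]; field_simp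
  have e2 : b * (l / v) = (a + b) * l := by rw [hv]; field_simp
  rw [e1] at h1
  rw [e2] at h2
  have hint : Integrable (fun ω => u * Real.exp (l / u * η ω) + v * Real.exp (l / v * θ ω)) P :=
    (h1.1.const_mul u).add (h2.1.const_mul v)
  have hle : ∀ ω, Real.exp (l * (η ω + θ ω)) ≤
      u * Real.exp (l / u * η ω) + v * Real.exp (l / v * θ ω) := by
    intro ω
    have := convexOn_exp.2 (Set.mem_univ (l / u * η ω)) (Set.mem_univ (l / v * θ ω))
      hu0.le hv0.le huv
    simp only [smul_eq_mul] at this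
    refine le_trans (le_of_eq ?_) this
    congr 1
    field_simp
  have hint' : Integrable (fun ω => Real.exp (l * (η ω + θ ω))) P := by
    refine hint.mono' (by fun_prop) (ae_of_all _ fun ω => ?_)
    rw [Real.norm_eq_abs, Real.abs_exp]
    exact hle ω
  refine ⟨hint', ?_⟩
  calc ∫ ω, Real.exp (l * (η ω + θ ω)) ∂P
      ≤ ∫ ω, u * Real.exp (l / u * η ω) + v * Real.exp (l / v * θ ω) ∂P :=
        integral_mono hint' hint hle
    _ = u * ∫ ω, Real.exp (l / u * η ω) ∂P + v * ∫ ω, Real.exp (l / v * θ ω) ∂P := by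
        rw [integral_add (h1.1.const_mul u) (h2.1.const_mul v), integral_const_mul,
          integral_const_mul]
    _ ≤ u * Real.exp (powPhi ζ ((a + b) * l)) + v * Real.exp (powPhi ζ ((a + b) * l)) := by
        gcongr
        · exact h1.2
        · exact h2.2
    _ = Real.exp (powPhi ζ ((a + b) * l)) := by rw [← add_mul, huv, one_mul]

theorem IsSubPhi.const_mul {η : Ω → ℝ} (h : IsSubPhi P (powPhi ζ) η) (c : ℝ) :
    IsSubPhi P (powPhi ζ) (fun ω => c * η ω) :=
  ⟨h.1.const_mul c, let ⟨_, ha⟩ := h.2; ⟨_, mem_subPhiBounds_const_mul ha c⟩⟩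

theorem IsSubPhi.add (hζ : 1 < ζ) {η θ : Ω → ℝ} (hη : IsSubPhi P (powPhi ζ) η)
    (hθ : IsSubPhi P (powPhi ζ) θ) : IsSubPhi P (powPhi ζ) (fun ω => η ω + θ ω) := by
  obtain ⟨a, ha⟩ := hη.2
  obtain ⟨b, hb⟩ := hθ.2
  exact ⟨hη.1.add hθ.1, _, mem_subPhiBounds_add hη.1 hθ.1
    (lt_of_le_of_lt ha.1 (lt_add_one a)) (lt_of_le_of_lt hb.1 (lt_add_one b))
    (mem_subPhiBounds_mono hζ ha (lt_add_one a).le)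
    (mem_subPhiBounds_mono hζ hb (lt_add_one b).le)⟩

theorem IsSubPhi.sub (hζ : 1 < ζ) {η θ : Ω → ℝ} (hη : IsSubPhi P (powPhi ζ) η)
    (hθ : IsSubPhi P (powPhi ζ) θ) : IsSubPhi P (powPhi ζ) (fun ω => η ω - θ ω) := by
  simpa [sub_eq_add_neg] using hη.add hζ (hθ.const_mul (-1))

theorem isSubPhi_zero [IsProbabilityMeasure P] (hζ : 1 < ζ) :
    IsSubPhi P (powPhi ζ) (fun _ => 0) := by
  refine ⟨measurable_const, 0, le_rfl, fun l => ⟨by simp, ?_⟩⟩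
  simp [powPhi, Real.zero_rpow (by linarith : ζ ≠ 0)]

theorem IsSubPhi.sum [IsProbabilityMeasure P] (hζ : 1 < ζ) {ι : Type*} (s : Finset ι)
    {η : ι → Ω → ℝ} (h : ∀ i ∈ s, IsSubPhi P (powPhi ζ) (η i)) :
    IsSubPhi P (powPhi ζ) (fun ω => ∑ i ∈ s, η i ω) := by
  classical
  induction s using Finset.induction_on with
  | empty => simpa using isSubPhi_zero hζ
  | insert i s hi ih =>
    simp only [Finset.sum_insert hi]
    exact (h i (by simp)).add hζ (ih fun j hj => h j (by simp [hj]))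

theorem lintegral_exp_mul_abs_le {η : Ω → ℝ} {a : ℝ}
    (ha : a ∈ subPhiBounds P (powPhi ζ) η) (l : ℝ) :
    ∫⁻ ω, ENNReal.ofReal (Real.exp (l * |η ω|)) ∂P ≤
      ENNReal.ofReal (2 * Real.exp (powPhi ζ (a * l))) := by
  have h1 := ha.2 l
  have h2 := ha.2 (-l)
  have e : powPhi ζ (a * -l) = powPhi ζ (a * l) := by simp [powPhi]
  rw [e] at h2
  calc ∫⁻ ω, ENNReal.ofReal (Real.exp (l * |η ω|)) ∂P
      ≤ ∫⁻ ω, ENNReal.ofReal (Real.exp (l * η ω) + Real.exp (-l * η ω)) ∂P := by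
        refine lintegral_mono fun ω => ENNReal.ofReal_le_ofReal ?_
        rcases abs_cases (η ω) with ⟨h, _⟩ | ⟨h, _⟩
        · rw [h]
          linarith [Real.exp_pos (-l * η ω)]
        · rw [h, mul_neg, ← neg_mul]
          linarith [Real.exp_pos (l * η ω)]
    _ = ENNReal.ofReal (∫ ω, Real.exp (l * η ω) + Real.exp (-l * η ω) ∂P) :=
        (ofReal_integral_eq_lintegral_ofReal (h1.1.add h2.1)
          (ae_of_all _ fun ω => (add_pos (Real.exp_pos _) (Real.exp_pos _)).le)).symm
    _ ≤ ENNReal.ofReal (2 * Real.exp (powPhi ζ (a * l))) := by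
        rw [integral_add h1.1 h2.1]
        exact ENNReal.ofReal_le_ofReal (by linarith [h1.2, h2.2])

theorem lintegral_enorm_le_of_mem_subPhiBounds (hζ : 1 < ζ) {η : Ω → ℝ} {c : ℝ}
    (hc : c ∈ subPhiBounds P (powPhi ζ) η) :
    ∫⁻ ω, ‖η ω‖ₑ ∂P ≤ ENNReal.ofReal (2 * Real.exp 1 * c) := by
  -- `c` may be `0`, so the estimate `|η| ≤ d exp (|η|/d)` is used for `d > c`, and then `d` tends
  -- to `c`.
  have key : ∀ d, c < d → ∫⁻ ω, ‖η ω‖ₑ ∂P ≤ ENNReal.ofReal (2 * Real.exp 1 * d) := by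
    intro d hd
    have hd0 : 0 < d := lt_of_le_of_lt hc.1 hd
    have h := lintegral_exp_mul_abs_le (mem_subPhiBounds_mono hζ hc hd.le)
      d⁻¹
    have e : powPhi ζ (d * d⁻¹) ≤ 1 := by
      rw [mul_inv_cancel₀ hd0.ne', powPhi, abs_one, Real.one_rpow]
      exact (div_le_one (by linarith)).2 hζ.le
    calc ∫⁻ ω, ‖η ω‖ₑ ∂P
        ≤ ∫⁻ ω, ENNReal.ofReal d * ENNReal.ofReal (Real.exp (d⁻¹ * |η ω|)) ∂P := by
          refine lintegral_mono fun ω => ?_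
          rw [Real.enorm_eq_ofReal_abs, ← ENNReal.ofReal_mul hd0.le]
          refine ENNReal.ofReal_le_ofReal ?_
          have := Real.add_one_le_exp (d⁻¹ * |η ω|)
          calc |η ω| = d * (d⁻¹ * |η ω|) := by field_simp
            _ ≤ d * Real.exp (d⁻¹ * |η ω|) := by gcongr; linarith
      _ = ENNReal.ofReal d * ∫⁻ ω, ENNReal.ofReal (Real.exp (d⁻¹ * |η ω|)) ∂P :=
          lintegral_const_mul' _ _ ENNReal.ofReal_ne_top
      _ ≤ ENNReal.ofReal d * ENNReal.ofReal (2 * Real.exp 1) := by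
          gcongr
          refine h.trans (ENNReal.ofReal_le_ofReal ?_)
          gcongr
      _ = ENNReal.ofReal (2 * Real.exp 1 * d) := by
          rw [← ENNReal.ofReal_mul hd0.le, mul_comm]
  have hlim : Tendsto (fun d : ℝ => ENNReal.ofReal (2 * Real.exp 1 * d)) (𝓝[>] c)
      (𝓝 (ENNReal.ofReal (2 * Real.exp 1 * c))) :=
    ((ENNReal.continuous_ofReal.comp (continuous_const.mul continuous_id)).tendsto c).mono_left
      nhdsWithin_le_nhds
  refine ge_of_tendsto hlim ?_
  filter_upwards [self_mem_nhdsWithin] with d hd using key d hd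

theorem IsSubPhi.integrable (hζ : 1 < ζ) {η : Ω → ℝ} (h : IsSubPhi P (powPhi ζ) η) :
    Integrable η P := by
  obtain ⟨c, hc⟩ := h.2
  exact ⟨h.1.aestronglyMeasurable,
    (lintegral_enorm_le_of_mem_subPhiBounds hζ hc).trans_lt ENNReal.ofReal_lt_top⟩

/-- Since `1 + l m ≤ exp (φ (a l))` for all `l`, with equality at `0`, and `φ` has zero derivative
at `0` because `ζ > 1`, the mean `m` must vanish. -/
theorem IsSubPhi.integral_eq_zero [IsProbabilityMeasure P] (hζ : 1 < ζ) {η : Ω → ℝ}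
    (h : IsSubPhi P (powPhi ζ) η) : ∫ ω, η ω ∂P = 0 := by
  obtain ⟨a, ha⟩ := h.2
  set m := ∫ ω, η ω ∂P with hm
  have hle : ∀ l : ℝ, 1 + l * m ≤ Real.exp (powPhi ζ (a * l)) := by
    intro l
    refine le_trans ?_ (ha.2 l).2
    have : 1 + l * m = ∫ ω, (1 + l * η ω) ∂P := by
      rw [integral_add (integrable_const _) ((h.integrable hζ).const_mul l),
        integral_const_mul]
      simp [hm]
    rw [this]
    refine integral_mono ((integrable_const _).add ((h.integrable hζ).const_mul l)) (ha.2 l).1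
      fun ω => ?_
    have := Real.add_one_le_exp (l * η ω)
    simp only
    linarith
  have hd0 : HasDerivAt (powPhi ζ) 0 (a * 0) := by
    have := (hasDerivAt_abs_rpow (a * 0) hζ).div_const ζ
    simp only [mul_zero, abs_zero, zero_div] at this ⊢
    exact this
  have hd : HasDerivAt (fun l : ℝ => Real.exp (powPhi ζ (a * l)) - l * m) (-m) 0 := by
    have h1 : HasDerivAt (fun l : ℝ => a * l) a 0 := by
      simpa using (hasDerivAt_id (0 : ℝ)).const_mul a
    have h2 := (hd0.comp (0 : ℝ) h1).exp
    have h3 : HasDerivAt (fun l : ℝ => l * m) m 0 := by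
      simpa using (hasDerivAt_id (0 : ℝ)).mul_const m
    have h4 := h2.sub h3
    simp only [mul_zero, zero_mul, zero_sub] at h4
    exact h4
  have hmin : IsLocalMin (fun l : ℝ => Real.exp (powPhi ζ (a * l)) - l * m) 0 := by
    refine Filter.Eventually.of_forall fun l => ?_
    have h0 : powPhi ζ (a * 0) = 0 := by
      simp [powPhi, Real.zero_rpow (by linarith : ζ ≠ 0)]
    simp only [h0, Real.exp_zero, zero_mul, sub_zero]
    linarith [hle l]
  simpa using hmin.hasDerivAt_eq_zero hd

/-- The moment generating function of the sum factorises, and the factor of the centred `U` is at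
least `1`. -/
theorem mem_subPhiBounds_of_indepFun_add [IsProbabilityMeasure P] (hζ : 1 < ζ) {U V : Ω → ℝ}
    (hU : IsSubPhi P (powPhi ζ) U) (hV : IsSubPhi P (powPhi ζ) V) (hUV : IndepFun U V P)
    {a : ℝ} (ha : a ∈ subPhiBounds P (powPhi ζ) (fun ω => U ω + V ω)) :
    a ∈ subPhiBounds P (powPhi ζ) V := by
  obtain ⟨u, hu⟩ := hU.2
  obtain ⟨v, hv⟩ := hV.2
  refine ⟨ha.1, fun l => ⟨(hv.2 l).1, le_trans ?_ (ha.2 l).2⟩⟩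
  have hmul : mgf (U + V) P l = mgf U P l * mgf V P l :=
    hUV.mgf_add (hu.2 l).1.aestronglyMeasurable (hv.2 l).1.aestronglyMeasurable
  have h1 : 1 ≤ mgf U P l := by
    have : (1 : ℝ) = ∫ ω, (1 + l * U ω) ∂P := by
      rw [integral_add (integrable_const _) ((hU.integrable hζ).const_mul l),
        integral_const_mul, hU.integral_eq_zero hζ]
      simp
    rw [this]
    refine integral_mono ((integrable_const _).add ((hU.integrable hζ).const_mul l)) (hu.2 l).1
      fun ω => ?_
    have := Real.add_one_le_exp (l * U ω)
    simp only
    linarith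
  change mgf V P l ≤ mgf (U + V) P l
  rw [hmul]
  exact le_mul_of_one_le_left mgf_nonneg h1

end SubPhi

/-! ### Increments of the error process for independent coefficients -/

theorem indepFun_of_tendsto_ae {Ω : Type*} {mΩ : MeasurableSpace Ω} {P : Measure Ω}
    {m₁ m₂ : MeasurableSpace Ω} (hm : Indep m₁ m₂ P)
    {U V : Ω → ℝ} {W : ℕ → Ω → ℝ} (hU : Measurable[m₁] U) (hW : ∀ n, Measurable[m₂] (W n))
    (hV : ∀ᵐ ω ∂P, Tendsto (fun n => W n ω) atTop (𝓝 (V ω))) : IndepFun U V P := by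
  -- `V` itself need not be `m₂`-measurable; the `limsup` is, and it agrees with `V` almost
  -- everywhere.
  have hV' : Measurable[m₂] (fun ω => limsup (fun n => W n ω) atTop) :=
    Measurable.limsup hW
  have hind : IndepFun U (fun ω => limsup (fun n => W n ω) atTop) P := by
    rw [IndepFun_iff_Indep]
    exact indep_of_indep_of_le_right (indep_of_indep_of_le_left hm hU.comap_le) hV'.comap_le
  refine hind.congr (ae_eq_refl _) ?_
  filter_upwards [hV] with ω hω using hω.limsup_eq

theorem exists_indep_of_iIndepFun {Ω : Type*} [MeasurableSpace Ω] {P : Measure Ω}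
    {ξ : ℕ → Ω → ℝ} (hξ : ∀ k, Measurable (ξ k)) (hind : iIndepFun ξ P) (N : ℕ) :
    ∃ m₁ m₂ : MeasurableSpace Ω, Indep m₁ m₂ P ∧ (∀ k ≤ N, Measurable[m₁] (ξ k)) ∧
      ∀ k, N < k → Measurable[m₂] (ξ k) := by
  have hdisj : Disjoint (Set.Iic N) (Set.Ioi N) := Set.Iic_disjoint_Ioi le_rfl
  have hmem : ∀ (A : Set ℕ) (k : ℕ), k ∈ A →
      Measurable[⨆ k ∈ A, MeasurableSpace.comap (ξ k) inferInstance] (ξ k) := fun A k hk =>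
    Measurable.mono (comap_measurable (ξ k))
      (le_iSup₂_of_le (f := fun k (_ : k ∈ A) => MeasurableSpace.comap (ξ k) inferInstance)
        k hk le_rfl) le_rfl
  exact ⟨_, _, indep_iSup_of_disjoint (fun k => (hξ k).comap_le)
    ((iIndepFun_iff_iIndep _ _ _).1 hind) hdisj, fun k hk => hmem _ k hk, fun k hk => hmem _ k hk⟩

section Model

variable {Ω : Type*} [MeasurableSpace Ω] {P : Measure Ω} {ζ : ℝ} {B : Type*}
  {X : B → Ω → ℝ} {ξ : ℕ → Ω → ℝ} {a : ℕ → B → ℝ}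

theorem isSubPhi_seriesModel [IsProbabilityMeasure P] (hζ : 1 < ζ)
    (hξ : ∀ k, IsSubPhi P (powPhi ζ) (ξ k)) (n : ℕ) (t : B) :
    IsSubPhi P (powPhi ζ) (seriesModel ξ a n t) := by
  refine IsSubPhi.sum hζ _ fun k _ => ?_
  simpa only [mul_comm] using (hξ k).const_mul (a k t)

theorem indepFun_seriesModel_modelError (hX : ∀ t, Measurable (X t))
    (hξ : ∀ k, Measurable (ξ k)) (hind : iIndepFun ξ P) (hseries : IsSeries P X ξ a)
    (N : ℕ) (t s : B) :
    IndepFun (fun ω => seriesModel ξ a N t ω - seriesModel ξ a N s ω)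
      (fun ω => modelError X (seriesModel ξ a N) t ω - modelError X (seriesModel ξ a N) s ω)
      P := by
  have hSm : ∀ n t, Measurable (seriesModel ξ a n t) := fun n t =>
    Finset.measurable_fun_sum _ fun k _ => (hξ k).mul_const _
  set W : ℕ → Ω → ℝ := fun n ω =>
    ∑ j ∈ Finset.range n, ξ (N + 1 + j) ω * (a (N + 1 + j) t - a (N + 1 + j) s) with hW
  set V : Ω → ℝ := fun ω =>
    modelError X (seriesModel ξ a N) t ω - modelError X (seriesModel ξ a N) s ω with hV
  have hWm : ∀ n, Measurable (W n) := fun n =>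
    Finset.measurable_fun_sum _ fun j _ => (hξ _).mul_const _
  have hsplit : ∀ n t ω, seriesModel ξ a (N + n) t ω = seriesModel ξ a N t ω +
      ∑ j ∈ Finset.range n, ξ (N + 1 + j) ω * a (N + 1 + j) t := by
    intro n t ω
    unfold seriesModel
    rw [show N + n + 1 = N + 1 + n by ring, Finset.sum_range_add]
  have hWe : ∀ n, W n - V = (fun ω => X s ω - seriesModel ξ a (N + n) s ω) -
      (fun ω => X t ω - seriesModel ξ a (N + n) t ω) := by
    intro n
    ext ω
    simp only [hW, hV, modelError, Pi.sub_apply, mul_sub, Finset.sum_sub_distrib, hsplit]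
    ring
  have hlim : Tendsto (fun n => eLpNorm (W n - V) 2 P) atTop (𝓝 0) := by
    have hshift : Tendsto (fun n => N + n) atTop atTop := by
      simpa only [add_comm] using tendsto_add_atTop_nat N
    have h1 := ((hseries s).comp hshift).add ((hseries t).comp hshift)
    rw [add_zero] at h1
    refine tendsto_of_tendsto_of_tendsto_of_le_of_le tendsto_const_nhds h1
      (fun _ => zero_le) fun n => ?_
    simp only [hWe]
    exact eLpNorm_sub_le ((hX s).sub (hSm _ s)).aestronglyMeasurable
      ((hX t).sub (hSm _ t)).aestronglyMeasurable (by norm_num)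
  have hVm : Measurable V := ((hX t).sub (hSm N t)).sub ((hX s).sub (hSm N s))
  -- Mean-square convergence of the tail sums gives almost sure convergence only along a
  -- subsequence, which suffices.
  obtain ⟨ns, -, hns⟩ := (tendstoInMeasure_of_tendsto_eLpNorm (by norm_num)
    (fun n => (hWm n).aestronglyMeasurable) hVm.aestronglyMeasurable hlim).exists_seq_tendsto_ae
  obtain ⟨m₁, m₂, hI, hm₁, hm₂⟩ := exists_indep_of_iIndepFun hξ hind N
  have hSN : ∀ t, Measurable[m₁] (seriesModel ξ a N t) := fun t =>
    Finset.measurable_fun_sum _ fun k hk =>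
      (hm₁ k (Nat.lt_succ_iff.1 (Finset.mem_range.1 hk))).mul_const _
  have hWn : ∀ n, Measurable[m₂] (W n) := fun n =>
    Finset.measurable_fun_sum _ fun j _ => (hm₂ (N + 1 + j) (by omega)).mul_const _
  exact indepFun_of_tendsto_ae hI ((hSN t).sub (hSN s)) (fun n => hWn (ns n)) hns

theorem IncrementBound.mem_subPhiBounds [PseudoMetricSpace B] (hζ : 1 < ζ) {σ : ℝ → ℝ}
    (hX : ∀ t, IsSubPhi P (powPhi ζ) (X t)) (hinc : IncrementBound P (powPhi ζ) X σ)
    {h : ℝ} (hh : 0 < h) {t s : B} (hts : dist t s ≤ h) :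
    σ h ∈ subPhiBounds P (powPhi ζ) (fun ω => X t ω - X s ω) :=
  mem_subPhiBounds_of_subPhiStd_le hζ ((hX t).sub hζ (hX s)).2 (hinc h hh t s hts)

theorem IncrementBound.modelError_of_iIndepFun [IsProbabilityMeasure P] [PseudoMetricSpace B]
    (hζ : 1 < ζ) {σ : ℝ → ℝ} (hX : ∀ t, IsSubPhi P (powPhi ζ) (X t))
    (hinc : IncrementBound P (powPhi ζ) X σ) (hξ : ∀ k, IsSubPhi P (powPhi ζ) (ξ k))
    (hseries : IsSeries P X ξ a) (hind : iIndepFun ξ P) (N : ℕ) :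
    IncrementBound P (powPhi ζ) (modelError X (seriesModel ξ a N)) σ := by
  intro h hh t s hts
  have hS := isSubPhi_seriesModel (a := a) hζ hξ N
  have hmem := hinc.mem_subPhiBounds hζ hX hh hts
  refine csInf_le ⟨0, fun x hx => hx.1⟩ (mem_subPhiBounds_of_indepFun_add hζ
    ((hS t).sub hζ (hS s)) (((hX t).sub hζ (hS t)).sub hζ ((hX s).sub hζ (hS s)))
    (indepFun_seriesModel_modelError (fun t => (hX t).1) (fun k => (hξ k).1) hind hseries N t s)
    ?_)
  convert hmem using 2 with ω
  ring_nf

end Model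

/-! ### Separability despite discontinuous coefficients -/

/-- The coefficient map into `L¹` has finite-dimensional range, hence a continuous linear section;
applying it to the `L¹`-continuous curve of sums gives `b`. The kernel is finitely generated, so one
null set serves all `t`. -/
theorem exists_continuous_coefficients {Ω : Type*} [MeasurableSpace Ω] {P : Measure Ω}
    {B : Type*} [TopologicalSpace B] {ι : Type*} [Fintype ι] {ξ : ι → Ω → ℝ}
    (hξ : ∀ k, Integrable (ξ k) P) (a : ι → B → ℝ)
    (hcont : ∀ t, Tendsto (fun s => ∫⁻ ω, ‖∑ k, a k s * ξ k ω - ∑ k, a k t * ξ k ω‖ₑ ∂P)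
      (𝓝 t) (𝓝 0)) :
    ∃ b : ι → B → ℝ, (∀ k, Continuous (b k)) ∧
      ∀ᵐ ω ∂P, ∀ t, ∑ k, a k t * ξ k ω = ∑ k, b k t * ξ k ω := by
  have hint : ∀ c : ι → ℝ, Integrable (fun ω => ∑ k, c k * ξ k ω) P := fun c =>
    integrable_finsetSum _ fun k _ => (hξ k).const_mul (c k)
  let L : (ι → ℝ) →ₗ[ℝ] (Ω →₁[P] ℝ) :=
    { toFun := fun c => (hint c).toL1 _
      map_add' := fun c d => by
        rw [← Integrable.toL1_add]
        congr 1
        ext ω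
        simp [add_mul, Finset.sum_add_distrib]
      map_smul' := fun r c => by
        rw [RingHom.id_apply, ← Integrable.toL1_smul]
        congr 1
        ext ω
        simp [Finset.mul_sum, mul_assoc] }
  have hLg : Continuous fun t => L fun k => a k t := by
    rw [continuous_iff_continuousAt]
    intro t
    rw [ContinuousAt, tendsto_iff_edist_tendsto_0]
    refine (hcont t).congr fun s => ?_
    change _ = edist ((hint fun k => a k s).toL1 _) ((hint fun k => a k t).toL1 _)
    rw [Integrable.edist_toL1_toL1]
    simp only [edist_eq_enorm_sub]
  obtain ⟨R, hR⟩ := L.rangeRestrict.exists_rightInverse_of_surjective L.range_rangeRestrict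
  have hRc : Continuous R := LinearMap.continuous_of_finiteDimensional R
  refine ⟨fun k t => R (L.rangeRestrict fun k => a k t) k, fun k => ?_, ?_⟩
  · exact (continuous_apply k).comp (hRc.comp (hLg.subtype_mk _))
  obtain ⟨S, hS⟩ := IsNoetherian.noetherian (LinearMap.ker L)
  have hS0 : ∀ᵐ ω ∂P, ∀ c ∈ S, ∑ k, c k * ξ k ω = 0 := by
    rw [Filter.eventually_all_finset]
    intro c hc
    have : c ∈ LinearMap.ker L := hS ▸ Submodule.subset_span hc
    have h0 : (hint c).toL1 _ = (integrable_zero Ω ℝ P).toL1 _ := by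
      rw [Integrable.toL1_zero]
      exact this
    exact (Integrable.toL1_eq_toL1_iff _ _ _ _).1 h0
  filter_upwards [hS0] with ω hω t
  have hker : LinearMap.ker L ≤ LinearMap.ker (Fintype.linearCombination ℝ fun k => ξ k ω) := by
    rw [← hS, Submodule.span_le]
    intro c hc
    simpa [Fintype.linearCombination_apply] using hω c hc
  have hmem : (fun k => a k t) - R (L.rangeRestrict fun k => a k t) ∈ LinearMap.ker L := by
    rw [LinearMap.mem_ker, map_sub, sub_eq_zero]
    have := LinearMap.congr_fun hR (L.rangeRestrict fun k => a k t)
    exact (congrArg Subtype.val this).symm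
  have := hker hmem
  rw [LinearMap.mem_ker, map_sub, sub_eq_zero] at this
  simpa [Fintype.linearCombination_apply] using this

theorem sub_mem_of_forall_separant {B : Type*} [TopologicalSpace B] {S : Set B} {x z : B → ℝ}
    (hx : ∀ U : Set B, IsOpen U → ∀ F : Set ℝ, IsClosed F →
      (∀ t ∈ U ∩ S, x t ∈ F) → ∀ t ∈ U, x t ∈ F)
    (hz : Continuous z) {F : Set ℝ} (hF : IsClosed F) (h : ∀ s ∈ S, x s - z s ∈ F) (t : B) :
    x t - z t ∈ F := by
  by_contra ht
  obtain ⟨ε, hε, hball⟩ := Metric.isOpen_iff.1 hF.isOpen_compl (x t - z t) ht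
  have hU : IsOpen {s | |z s - z t| < ε / 2} :=
    isOpen_lt (by fun_prop) continuous_const
  have hG : IsClosed {y : ℝ | ε / 2 ≤ |y - x t|} :=
    isClosed_le continuous_const (by fun_prop)
  -- Separability is applied to the closed set of values at distance at least `ε/2` from `x t`,
  -- which `x t` itself cannot belong to.
  have := hx _ hU _ hG (fun s hs => ?_) t (by simpa using hε)
  · simp only [Set.mem_ofPred_eq, sub_self, abs_zero] at this
    linarith
  · by_contra hlt
    simp only [Set.mem_ofPred_eq, not_le] at hlt
    refine hball ?_ (h s hs.2)
    rw [Metric.mem_ball, Real.dist_eq]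
    have h1 : |z s - z t| < ε / 2 := hs.1
    calc |x s - z s - (x t - z t)| = |(x s - x t) - (z s - z t)| := by ring_nf
      _ ≤ |x s - x t| + |z s - z t| := abs_sub _ _
      _ < ε := by linarith

/-! ### The chaining majorant -/

/-- Jensen's inequality with the missing mass placed at `0`, proved from the tangent to `exp` at
`m`. -/
theorem exp_sum_mul_le {ι : Type*} (s : Finset ι) {w y : ι → ℝ} (hw : ∀ j ∈ s, 0 ≤ w j)
    (hw1 : ∑ j ∈ s, w j ≤ 1) :
    Real.exp (∑ j ∈ s, w j * y j) ≤ (1 - ∑ j ∈ s, w j) + ∑ j ∈ s, w j * Real.exp (y j) := by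
  set m := ∑ j ∈ s, w j * y j with hm
  set W := ∑ j ∈ s, w j with hW
  have tangent : ∀ x, Real.exp m * (1 + x - m) ≤ Real.exp x := by
    intro x
    have h := mul_le_mul_of_nonneg_left (Real.add_one_le_exp (x - m)) (Real.exp_pos m).le
    rw [← Real.exp_add, add_sub_cancel] at h
    linarith
  have h1 : ∑ j ∈ s, w j * (Real.exp m * (1 + y j - m)) ≤ ∑ j ∈ s, w j * Real.exp (y j) :=
    Finset.sum_le_sum fun j hj => mul_le_mul_of_nonneg_left (tangent _) (hw j hj)
  have h2 : ∑ j ∈ s, w j * (Real.exp m * (1 + y j - m)) =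
      Real.exp m * (W * (1 - m) + m) := by
    rw [hW, Finset.sum_mul, hm, ← hm, ← Finset.sum_add_distrib, Finset.mul_sum]
    refine Finset.sum_congr rfl fun j _ => ?_
    ring
  have h3 := mul_le_mul_of_nonneg_left (tangent 0) (sub_nonneg.2 hw1)
  rw [Real.exp_zero] at h3
  nlinarith

section Chaining

variable {Ω : Type*} [MeasurableSpace Ω] {P : Measure Ω}

/-- `H` sums over all links of all levels, so it dominates every chain at once; the factor `w j *
exp (-L j)` leaves level `j` an expectation of at most `w j`. -/
theorem exists_majorant_of_links {w L : ℕ → ℝ} (hw : ∀ j, 0 < w j) (hw1 : HasSum w 1)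
    (M : ℕ → ℕ) {f : ℕ → ℕ → Ω → ℝ} (hf : ∀ j i, Measurable (f j i)) (l : ℝ)
    (hL : ∀ j, ∑ i ∈ Finset.range (M j),
      ∫⁻ ω, ENNReal.ofReal (Real.exp (l / w j * |f j i ω|)) ∂P ≤
        ENNReal.ofReal (Real.exp (L j))) :
    ∃ H : Ω → ENNReal, Measurable H ∧ ∫⁻ ω, H ω ∂P ≤ 1 ∧
      ∀ ω (i : ℕ → ℕ) (n : ℕ), (∀ j < n, i j < M j) →
        ENNReal.ofReal (Real.exp (l * ∑ j ∈ Finset.range n, |f j (i j) ω| -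
          ∑ j ∈ Finset.range n, w j * L j)) ≤
        ENNReal.ofReal (1 - ∑ j ∈ Finset.range n, w j) + H ω := by
  have hgm : ∀ j i, Measurable fun ω => ENNReal.ofReal (Real.exp (l / w j * |f j i ω|)) :=
    fun j i => ((measurable_norm.comp (hf j i)).const_mul _).exp.ennreal_ofReal
  have hGm : ∀ j, Measurable fun ω => ENNReal.ofReal (w j * Real.exp (-L j)) *
      ∑ i ∈ Finset.range (M j), ENNReal.ofReal (Real.exp (l / w j * |f j i ω|)) :=
    fun j => (Finset.measurable_fun_sum _ fun i _ => hgm j i).const_mul _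
  refine ⟨fun ω => ∑' j, ENNReal.ofReal (w j * Real.exp (-L j)) *
    ∑ i ∈ Finset.range (M j), ENNReal.ofReal (Real.exp (l / w j * |f j i ω|)),
    Measurable.tsum hGm, ?_, fun ω i n hi => ?_⟩
  · rw [lintegral_tsum fun j => (hGm j).aemeasurable]
    calc ∑' j, ∫⁻ ω, ENNReal.ofReal (w j * Real.exp (-L j)) *
          ∑ i ∈ Finset.range (M j), ENNReal.ofReal (Real.exp (l / w j * |f j i ω|)) ∂P
        ≤ ∑' j, ENNReal.ofReal (w j) := by
          refine ENNReal.tsum_le_tsum fun j => ?_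
          rw [lintegral_const_mul' _ _ ENNReal.ofReal_ne_top,
            lintegral_finsetSum _ fun i _ => hgm j i]
          refine (mul_le_mul_right (hL j) _).trans (le_of_eq ?_)
          rw [← ENNReal.ofReal_mul (mul_pos (hw j) (Real.exp_pos _)).le, mul_assoc,
            ← Real.exp_add, neg_add_cancel, Real.exp_zero, mul_one]
      _ = 1 := by
          rw [← ENNReal.ofReal_tsum_of_nonneg (fun j => (hw j).le) hw1.summable, hw1.tsum_eq,
            ENNReal.ofReal_one]
  · have hW1 : ∑ j ∈ Finset.range n, w j ≤ 1 :=
      sum_le_hasSum _ (fun j _ => (hw j).le) hw1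
    have h := exp_sum_mul_le (Finset.range n) (w := w)
      (y := fun j => l / w j * |f j (i j) ω| - L j) (fun j _ => (hw j).le) hW1
    have e : ∑ j ∈ Finset.range n, w j * (l / w j * |f j (i j) ω| - L j) =
        l * ∑ j ∈ Finset.range n, |f j (i j) ω| - ∑ j ∈ Finset.range n, w j * L j := by
      rw [Finset.mul_sum, ← Finset.sum_sub_distrib]
      refine Finset.sum_congr rfl fun j _ => ?_
      have := (hw j).ne'
      field_simp
    rw [e] at h
    refine (ENNReal.ofReal_le_ofReal h).trans ?_
    rw [ENNReal.ofReal_add (sub_nonneg.2 hW1)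
      (Finset.sum_nonneg fun j _ => mul_nonneg (hw j).le (Real.exp_pos _).le),
      ENNReal.ofReal_sum_of_nonneg fun j _ => mul_nonneg (hw j).le (Real.exp_pos _).le]
    refine add_le_add le_rfl (le_trans (Finset.sum_le_sum fun j hj => ?_)
      (ENNReal.sum_le_tsum (Finset.range n)))
    have : w j * Real.exp (l / w j * |f j (i j) ω| - L j) =
        w j * Real.exp (-L j) * Real.exp (l / w j * |f j (i j) ω|) := by
      rw [mul_assoc, ← Real.exp_add]
      ring_nf
    rw [this, ENNReal.ofReal_mul (mul_pos (hw j) (Real.exp_pos _)).le]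
    refine mul_le_mul_right ?_ _
    exact Finset.single_le_sum
      (f := fun i => ENNReal.ofReal (Real.exp (l / w j * |f j i ω|)))
      (fun _ _ => zero_le) (Finset.mem_range.2 (hi j (Finset.mem_range.1 hj)))

theorem ae_tendsto_of_summable_lintegral_enorm_le {V : Ω → ℝ} {Y : ℕ → Ω → ℝ}
    (hV : Measurable V) (hY : ∀ n, Measurable (Y n)) {c : ℕ → ℝ} (hc0 : ∀ n, 0 ≤ c n)
    (hc : Summable c) (h : ∀ n, ∫⁻ ω, ‖V ω - Y n ω‖ₑ ∂P ≤ ENNReal.ofReal (c n)) :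
    ∀ᵐ ω ∂P, Tendsto (fun n => Y n ω) atTop (𝓝 (V ω)) := by
  have hm : ∀ n, Measurable fun ω => ‖V ω - Y n ω‖ₑ := fun n => (hV.sub (hY n)).enorm
  have hfin : ∫⁻ ω, ∑' n, ‖V ω - Y n ω‖ₑ ∂P ≠ ⊤ := by
    rw [lintegral_tsum fun n => (hm n).aemeasurable]
    refine ((ENNReal.tsum_le_tsum h).trans_lt ?_).ne
    rw [← ENNReal.ofReal_tsum_of_nonneg hc0 hc]
    exact ENNReal.ofReal_lt_top
  filter_upwards [ae_lt_top (Measurable.tsum hm) hfin] with ω hω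
  rw [tendsto_iff_edist_tendsto_0]
  refine (ENNReal.tendsto_atTop_zero_of_tsum_ne_top hω.ne).congr fun n => ?_
  rw [edist_comm, edist_eq_enorm_sub]

theorem exists_chain {B : Type*} {x : B → ℝ} (v : ℕ → ℕ → B) {M : ℕ → ℕ} {π : ℕ → B → ℕ}
    (hπ : ∀ j t, π j t < M j) {f : ℕ → ℕ → ℝ} (hf0 : ∀ i, f 0 i = x (v 0 i))
    (hf : ∀ j i, f (j + 1) i = x (v (j + 1) i) - x (v j (π j (v (j + 1) i)))) (n : ℕ) :
    ∀ i < M n, ∃ k : ℕ → ℕ, (∀ j < n + 1, k j < M j) ∧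
      |x (v n i)| ≤ ∑ j ∈ Finset.range (n + 1), |f j (k j)| := by
  induction n with
  | zero =>
    intro i hi
    refine ⟨fun _ => i, fun j hj => ?_, ?_⟩
    · obtain rfl : j = 0 := by omega
      exact hi
    · simp [hf0]
  | succ n ih =>
    intro i hi
    obtain ⟨k, hk, hle⟩ := ih _ (hπ n (v (n + 1) i))
    refine ⟨fun j => if j = n + 1 then i else k j, fun j hj => ?_, ?_⟩
    · by_cases h : j = n + 1
      · simpa [h] using hi
      · simpa [h] using hk j (by omega)
    · rw [Finset.sum_range_succ]
      have e : ∑ j ∈ Finset.range (n + 1), |f j (if j = n + 1 then i else k j)| =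
          ∑ j ∈ Finset.range (n + 1), |f j (k j)| := by
        refine Finset.sum_congr rfl fun j hj => ?_
        rw [if_neg (Finset.mem_range.1 hj).ne]
      simp only [e, if_true, hf]
      have := abs_add_le (x (v n (π n (v (n + 1) i))))
        (x (v (n + 1) i) - x (v n (π n (v (n + 1) i))))
      rw [add_sub_cancel] at this
      linarith

theorem exists_majorant_of_nets {ζ : ℝ} (hζ : 1 < ζ) {B : Type*} {D : B → Ω → ℝ}
    (hD : ∀ t, Measurable (D t)) (v : ℕ → ℕ → B) {M : ℕ → ℕ} {π : ℕ → B → ℕ}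
    (hπ : ∀ j t, π j t < M j) {c : ℕ → ℝ} (hc : Summable c)
    (h0 : ∀ i, c 0 ∈ subPhiBounds P (powPhi ζ) (D (v 0 i)))
    (hstep : ∀ j t,
      c (j + 1) ∈ subPhiBounds P (powPhi ζ) (fun ω => D t ω - D (v j (π j t)) ω))
    {w L : ℕ → ℝ} (hw : ∀ j, 0 < w j) (hw1 : HasSum w 1) {l : ℝ} (hl : 0 ≤ l)
    (hL : ∀ j, M j * (2 * Real.exp (powPhi ζ (c j * (l / w j)))) ≤ Real.exp (L j))
    {A : ℝ} (hA : ∀ n, ∑ j ∈ Finset.range n, w j * L j ≤ A) :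
    ∃ H : Ω → ENNReal, Measurable H ∧ ∫⁻ ω, H ω ∂P ≤ 1 ∧
      ∀ t, ∀ᵐ ω ∂P, ENNReal.ofReal (Real.exp (l * |D t ω| - A)) ≤ H ω := by
  let f : ℕ → ℕ → Ω → ℝ := fun j i ω => match j with
    | 0 => D (v 0 i) ω
    | j + 1 => D (v (j + 1) i) ω - D (v j (π j (v (j + 1) i))) ω
  have hfm : ∀ j i, Measurable (f j i) := by
    rintro (_ | j) i
    · exact hD _
    · exact (hD _).sub (hD _)
  have hfc : ∀ j i, c j ∈ subPhiBounds P (powPhi ζ) (f j i) := by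
    rintro (_ | j) i
    · exact h0 i
    · exact hstep j _
  obtain ⟨H, hHm, hH1, hH⟩ := exists_majorant_of_links (P := P) hw hw1 M hfm l (L := L) <| by
    intro j
    refine (Finset.sum_le_sum fun i _ => lintegral_exp_mul_abs_le (hfc j i) (l / w j)).trans ?_
    rw [Finset.sum_const, Finset.card_range, nsmul_eq_mul, ← ENNReal.ofReal_natCast,
      ← ENNReal.ofReal_mul (Nat.cast_nonneg _)]
    exact ENNReal.ofReal_le_ofReal (hL j)
  refine ⟨H, hHm, hH1, fun t => ?_⟩
  have hc0 : ∀ n, 0 ≤ 2 * Real.exp 1 * c (n + 1) := fun n =>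
    mul_nonneg (by positivity) (hstep n t).1
  -- Summable `L¹` errors give convergence along the nets for each fixed `t`, without path
  -- continuity; the null set depends on `t`.
  have hlim := ae_tendsto_of_summable_lintegral_enorm_le (P := P) (hD t)
    (fun n => hD (v n (π n t))) hc0 (((summable_nat_add_iff 1).2 hc).mul_left _)
    (fun n => lintegral_enorm_le_of_mem_subPhiBounds hζ (hstep n t))
  filter_upwards [hlim] with ω hω
  have hleft : Tendsto (fun n => ENNReal.ofReal (Real.exp (l * |D (v n (π n t)) ω| - A))) atTop
      (𝓝 (ENNReal.ofReal (Real.exp (l * |D t ω| - A)))) :=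
    ((ENNReal.continuous_ofReal.comp
      (by fun_prop : Continuous fun x : ℝ => Real.exp (l * |x| - A))).tendsto (D t ω)).comp hω
  have hright : Tendsto (fun n => ENNReal.ofReal (1 - ∑ j ∈ Finset.range (n + 1), w j) + H ω)
      atTop (𝓝 (H ω)) := by
    have h1 := (hw1.tendsto_sum_nat.comp (tendsto_add_atTop_nat 1)).const_sub 1
    rw [sub_self] at h1
    have h2 := (ENNReal.tendsto_ofReal h1).add_const (H ω)
    rwa [ENNReal.ofReal_zero, zero_add] at h2
  refine le_of_tendsto_of_tendsto' hleft hright fun n => ?_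
  obtain ⟨k, hk, hle⟩ := exists_chain (x := fun t => D t ω) v hπ (f := fun j i => f j i ω)
    (fun _ => rfl) (fun _ _ => rfl) n _ (hπ n t)
  refine le_trans (ENNReal.ofReal_le_ofReal (Real.exp_le_exp.2 ?_)) (hH ω k (n + 1) hk)
  exact sub_le_sub (mul_le_mul_of_nonneg_left hle hl) (hA _)

end Chaining

/-! ### Separability of the error process -/

theorem exists_ae_forall_modelError_mem {Ω : Type*} [MeasurableSpace Ω] {P : Measure Ω}
    [IsProbabilityMeasure P] {ζ : ℝ} (hζ : 1 < ζ) {B : Type*} [MetricSpace B]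
    {C α : ℝ} (hα : 0 < α) {X : B → Ω → ℝ} (hX : ∀ t, IsSubPhi P (powPhi ζ) (X t))
    (hsep : IsSeparablePaths P X)
    (hinc : IncrementBound P (powPhi ζ) X (fun h => C * h ^ α))
    {ξ : ℕ → Ω → ℝ} {a : ℕ → B → ℝ} (hξ : ∀ k, IsSubPhi P (powPhi ζ) (ξ k)) {N : ℕ}
    (hΔ : IncrementBound P (powPhi ζ) (modelError X (seriesModel ξ a N))
      (fun h => C * h ^ α)) :
    ∃ S : Set B, S.Countable ∧ ∀ᵐ ω ∂P, ∀ F : Set ℝ, IsClosed F →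
      (∀ s ∈ S, modelError X (seriesModel ξ a N) s ω ∈ F) →
        ∀ t, modelError X (seriesModel ξ a N) t ω ∈ F := by
  have hS := isSubPhi_seriesModel (a := a) hζ hξ N
  have hD : ∀ t, IsSubPhi P (powPhi ζ) (modelError X (seriesModel ξ a N) t) :=
    fun t => (hX t).sub hζ (hS t)
  have hmodel : ∀ t ω, seriesModel ξ a N t ω =
      ∑ k : Fin (N + 1), a k t * ξ k ω := by
    intro t ω
    simp only [seriesModel, Finset.sum_range, mul_comm]
  -- A model increment is an increment of `X` minus one of the error, and (2) controls both in `L¹`.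
  have hbound : ∀ t s, ∫⁻ ω, ‖seriesModel ξ a N s ω - seriesModel ξ a N t ω‖ₑ ∂P ≤
      ENNReal.ofReal (2 * Real.exp 1 * (C * dist s t ^ α)) +
        ENNReal.ofReal (2 * Real.exp 1 * (C * dist s t ^ α)) := by
    intro t s
    rcases eq_or_ne s t with rfl | hst
    · simp
    have hd : 0 < dist s t := dist_pos.2 hst
    have h1 := lintegral_enorm_le_of_mem_subPhiBounds hζ
      (hinc.mem_subPhiBounds hζ hX hd le_rfl)
    have h2 := lintegral_enorm_le_of_mem_subPhiBounds hζ
      (hΔ.mem_subPhiBounds hζ hD hd le_rfl)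
    refine le_trans ?_ (add_le_add h1 h2)
    have hm : Measurable fun ω => ‖X s ω - X t ω‖ₑ := ((hX s).1.sub (hX t).1).enorm
    rw [← lintegral_add_left hm]
    refine lintegral_mono fun ω => ?_
    have : seriesModel ξ a N s ω - seriesModel ξ a N t ω = (X s ω - X t ω) -
        (modelError X (seriesModel ξ a N) s ω - modelError X (seriesModel ξ a N) t ω) := by
      simp only [modelError]
      ring
    rw [this]
    exact enorm_sub_le
  have hcont : ∀ t, Tendsto (fun s => ∫⁻ ω, ‖∑ k : Fin (N + 1), a k s * ξ k ω -
      ∑ k : Fin (N + 1), a k t * ξ k ω‖ₑ ∂P) (𝓝 t) (𝓝 0) := by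
    intro t
    have hlim : Tendsto (fun s => ENNReal.ofReal (2 * Real.exp 1 * (C * dist s t ^ α)))
        (𝓝 t) (𝓝 0) := by
      have hc : Continuous fun s => ENNReal.ofReal (2 * Real.exp 1 * (C * dist s t ^ α)) :=
        ENNReal.continuous_ofReal.comp (continuous_const.mul (continuous_const.mul
          ((continuous_id.dist continuous_const).rpow_const fun _ => Or.inr hα.le)))
      simpa [Real.zero_rpow hα.ne'] using hc.tendsto t
    have hlim2 := hlim.add hlim
    rw [add_zero] at hlim2
    refine tendsto_of_tendsto_of_tendsto_of_le_of_le tendsto_const_nhds hlim2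
      (fun _ => zero_le) fun s => ?_
    simpa only [hmodel] using hbound t s
  obtain ⟨b, hb, hab⟩ := exists_continuous_coefficients
    (fun k : Fin (N + 1) => (hξ k).integrable hζ) (fun k => a k) hcont
  obtain ⟨S, hSc, -, hSX⟩ := hsep
  refine ⟨S, hSc, ?_⟩
  filter_upwards [hSX, hab] with ω hω1 hω2 F hF hs t
  have he : ∀ t, modelError X (seriesModel ξ a N) t ω =
      X t ω - ∑ k : Fin (N + 1), b k t * ξ k ω := by
    intro t
    rw [modelError, hmodel, hω2 t]
  simp only [he] at hs ⊢
  exact sub_mem_of_forall_separant hω1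
    (continuous_finsetSum _ fun k _ => (hb k).mul continuous_const) hF hs t

/-! ### Nets and explicit constants on the interval -/

theorem exists_net_Icc {T : ℝ} (hT : 0 < T) {m : ℕ} (hm : 0 < m) :
    ∃ (v : ℕ → Set.Icc (0 : ℝ) T) (π : Set.Icc (0 : ℝ) T → ℕ),
      ∀ t, π t < m ∧ dist t (v (π t)) ≤ T / (2 * m) := by
  have hm' : (0 : ℝ) < m := Nat.cast_pos.2 hm
  suffices h : ∀ t : Set.Icc (0 : ℝ) T, ∃ i : ℕ, i < m ∧
      dist t (Set.projIcc 0 T hT.le (T / m * (i + 1 / 2))) ≤ T / (2 * m) by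
    choose π hπ using h
    exact ⟨fun i => Set.projIcc 0 T hT.le (T / m * (i + 1 / 2)), π, hπ⟩
  rintro ⟨t, ht0, htT⟩
  have hx : ∃ i : ℕ, i < m ∧ |t * m / T - (i + 1 / 2)| ≤ 1 / 2 := by
    -- The net consists of cell midpoints; at the right endpoint the floor would be `m`, so the last
    -- cell is taken instead.
    rcases htT.eq_or_lt with rfl | hlt
    · obtain ⟨k, rfl⟩ := Nat.exists_eq_succ_of_ne_zero hm.ne'
      refine ⟨k, Nat.lt_succ_self k, ?_⟩
      rw [mul_div_cancel_left₀ _ hT.ne']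
      push_cast
      rw [abs_le]
      constructor <;> linarith
    · have h0 : 0 ≤ t * m / T := by positivity
      refine ⟨⌊t * m / T⌋₊, ?_, ?_⟩
      · rw [Nat.floor_lt h0, div_lt_iff₀ hT, mul_comm (m : ℝ)]
        gcongr
      · have h1 := Nat.floor_le h0
        have h2 := Nat.lt_floor_add_one (t * m / T)
        rw [abs_le]
        constructor <;> linarith
  obtain ⟨i, hi, hd⟩ := hx
  refine ⟨i, hi, ?_⟩
  have hi' : (i : ℝ) + 1 ≤ m := by exact_mod_cast hi
  have hmem : T / m * (i + 1 / 2) ∈ Set.Icc 0 T := by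
    constructor
    · positivity
    · rw [div_mul_eq_mul_div, div_le_iff₀ hm']
      gcongr
      linarith
  rw [Set.projIcc_of_mem hT.le hmem, Subtype.dist_eq, Real.dist_eq]
  have e : t - T / m * (i + 1 / 2) = T / m * (t * m / T - (i + 1 / 2)) := by field_simp
  simp only [e]
  rw [abs_mul, abs_of_pos (by positivity : 0 < T / m)]
  calc T / m * |t * m / T - (i + 1 / 2)| ≤ T / m * (1 / 2) := by gcongr
    _ = T / (2 * m) := by field_simp

theorem le_radiusBeta_Icc {T : ℝ} (hT : 0 < T) {C : ℝ} (hC : 0 ≤ C) {α : ℝ} (hα : 0 < α) :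
    C * (T / 2) ^ α ≤ radiusBeta (Set.Icc (0 : ℝ) T) (fun h => C * h ^ α) := by
  have : Nonempty (Set.Icc (0 : ℝ) T) := ⟨⟨0, le_rfl, hT.le⟩⟩
  unfold radiusBeta
  simp only
  gcongr
  refine le_ciInf fun s => ?_
  have hb : BddAbove (Set.range fun t : Set.Icc (0 : ℝ) T => dist t s) := by
    refine ⟨T, ?_⟩
    rintro _ ⟨t, rfl⟩
    have := Real.dist_le_of_mem_Icc t.2 s.2
    simpa [Subtype.dist_eq] using this
  rcases le_total (s : ℝ) (T / 2) with h | h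
  · refine le_trans ?_ (le_ciSup hb ⟨T, hT.le, le_rfl⟩)
    rw [Subtype.dist_eq, Real.dist_eq]
    refine le_trans ?_ (le_abs_self _)
    simp only
    linarith
  · refine le_trans ?_ (le_ciSup hb ⟨0, le_rfl, hT.le⟩)
    rw [Subtype.dist_eq, Real.dist_eq]
    refine le_trans ?_ (neg_le_abs _)
    simp only
    linarith

/-- Equivalent to `log (1/p) ≤ 1/p - 1`; this is the source of the factor `e` in the final bound. -/
theorem neg_log_div_one_sub_le {p : ℝ} (hp0 : 0 < p) (hp1 : p < 1) :
    -Real.log p / (1 - p) ≤ 1 - Real.log p := by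
  have h := Real.log_le_sub_one_of_pos (inv_pos.2 hp0)
  rw [Real.log_inv] at h
  have h2 := mul_le_mul_of_nonneg_left h hp0.le
  rw [mul_sub, mul_inv_cancel₀ hp0.ne'] at h2
  rw [div_le_iff₀ (by linarith)]
  nlinarith

theorem exists_chernoff_parameter {ζ γ δ β : ℝ} (hζ : 1 < ζ) (hγ : 0 < γ) (hδ : γ < δ)
    (hβ : 0 ≤ β) :
    ∃ l : ℝ, 0 ≤ l ∧
      (1 - γ / δ) * powPhi ζ (γ * l / (1 - γ / δ)) +
        γ / δ * powPhi ζ (β * l / (1 - γ / δ)) - l * δ =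
      -((ζ - 1) * δ ^ (1 / (ζ - 1)) * (δ - γ) ^ (ζ / (ζ - 1)) /
        (ζ * (γ ^ ζ * (δ - γ) + β ^ ζ * γ) ^ (1 / (ζ - 1)))) := by
  have hδ0 : 0 < δ := hγ.trans hδ
  have hd : 0 < δ - γ := sub_pos.2 hδ
  have hz : 0 < ζ - 1 := sub_pos.2 hζ
  have hz0 : 0 < ζ := by linarith
  set m := γ ^ ζ * (δ - γ) + β ^ ζ * γ with hm
  have hm0 : 0 < m := by
    have := Real.rpow_nonneg hβ ζ
    positivity
  -- The expression has the form `K l^ζ / ζ - l δ`; this is its minimiser, the root of `K l^(ζ-1) =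
  -- δ`, where the value is `-(1 - 1/ζ) l δ`.
  set l := δ ^ (1 / (ζ - 1)) / δ * (δ - γ) ^ (ζ / (ζ - 1)) / m ^ (1 / (ζ - 1)) with hl
  have hl0 : 0 < l := by positivity
  refine ⟨l, hl0.le, ?_⟩
  have hinv : ∀ {x : ℝ}, 0 < x → (x ^ (1 / (ζ - 1))) ^ (ζ - 1) = x := fun hx => by
    rw [← Real.rpow_mul hx.le, one_div_mul_cancel hz.ne', Real.rpow_one]
  have hpow : l ^ (ζ - 1) = δ / δ ^ (ζ - 1) * (δ - γ) ^ ζ / m := by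
    rw [hl, Real.div_rpow (by positivity) (by positivity),
      Real.mul_rpow (by positivity) (by positivity), Real.div_rpow (by positivity) hδ0.le,
      hinv hδ0, hinv hm0, ← Real.rpow_mul hd.le, div_mul_cancel₀ _ hz.ne']
  have hlz : l ^ ζ = l ^ (ζ - 1) * l := by
    rw [← Real.rpow_add_one hl0.ne', sub_add_cancel]
  have hδz : δ ^ ζ = δ ^ (ζ - 1) * δ := by
    rw [← Real.rpow_add_one hδ0.ne', sub_add_cancel]
  have hphi : ∀ x, 0 ≤ x → powPhi ζ (x * l / (1 - γ / δ)) =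
      x ^ ζ * l ^ ζ * δ ^ ζ / (δ - γ) ^ ζ / ζ := by
    intro x hx
    have : x * l / (1 - γ / δ) = x * l * δ / (δ - γ) := by
      field_simp
    rw [powPhi, this, abs_of_nonneg (by positivity), Real.div_rpow (by positivity) hd.le,
      Real.mul_rpow (by positivity) hδ0.le, Real.mul_rpow hx hl0.le]
  have hsum : (1 - γ / δ) * powPhi ζ (γ * l / (1 - γ / δ)) +
      γ / δ * powPhi ζ (β * l / (1 - γ / δ)) = l * δ / ζ := by
    rw [hphi γ hγ.le, hphi β hβ]
    have h1 : (1 - γ / δ) * (γ ^ ζ * l ^ ζ * δ ^ ζ / (δ - γ) ^ ζ / ζ) +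
        γ / δ * (β ^ ζ * l ^ ζ * δ ^ ζ / (δ - γ) ^ ζ / ζ) =
        m * l ^ ζ * δ ^ ζ / (δ - γ) ^ ζ / ζ / δ := by
      rw [hm]
      field_simp
    rw [h1, hlz, hpow, hδz]
    have : δ ^ (ζ - 1) ≠ 0 := by positivity
    have : (δ - γ) ^ ζ ≠ 0 := by positivity
    field_simp
  rw [hsum]
  have hlδ : l * δ = δ ^ (1 / (ζ - 1)) * (δ - γ) ^ (ζ / (ζ - 1)) / m ^ (1 / (ζ - 1)) := by
    rw [hl]
    field_simp
  rw [hlδ]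
  have : m ^ (1 / (ζ - 1)) ≠ 0 := by positivity
  field_simp
  ring

theorem sum_chaining_weights_le {p : ℝ} (hp0 : 0 < p) (hp1 : p < 1) {k κ Φ₀ Φ₁ : ℝ} (hk : 0 ≤ k)
    (hκ : 0 ≤ κ) (hΦ₀ : 0 ≤ Φ₀) (hΦ₁ : 0 ≤ Φ₁) (n : ℕ) :
    ∑ j ∈ Finset.range n, p ^ j * (1 - p) * (k + (j + 1) * κ + if j = 0 then Φ₀ else Φ₁) ≤
      k + κ / (1 - p) + ((1 - p) * Φ₀ + p * Φ₁) := by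
  have hq : 0 < 1 - p := sub_pos.2 hp1
  have hgeo : HasSum (fun j : ℕ => p ^ j) (1 - p)⁻¹ := hasSum_geometric_of_lt_one hp0.le hp1
  have hlin : HasSum (fun j : ℕ => (j : ℝ) * p ^ j) (p / (1 - p) ^ 2) :=
    hasSum_coe_mul_geometric_of_norm_lt_one (by rwa [Real.norm_of_nonneg hp0.le])
  have hsingle : HasSum (fun j : ℕ => if j = 0 then (1 - p) * (Φ₀ - Φ₁) else 0)
      ((1 - p) * (Φ₀ - Φ₁)) := hasSum_ite_eq 0 _
  have htot := ((hgeo.mul_left ((1 - p) * (k + κ + Φ₁))).add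
    (hlin.mul_left ((1 - p) * κ))).add hsingle
  have hval : (1 - p) * (k + κ + Φ₁) * (1 - p)⁻¹ + (1 - p) * κ * (p / (1 - p) ^ 2) +
      (1 - p) * (Φ₀ - Φ₁) = k + κ / (1 - p) + ((1 - p) * Φ₀ + p * Φ₁) := by
    field_simp
    ring
  rw [hval] at htot
  refine sum_le_hasSum _ (fun j _ => ?_) (htot.congr_fun fun j => ?_)
  · split_ifs <;> positivity
  · rcases eq_or_ne j 0 with rfl | hj
    · simp
      ring
    · simp only [if_neg hj]
      ring

theorem exists_majorant_Icc {Ω : Type*} [MeasurableSpace Ω] {P : Measure Ω}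
    {ζ : ℝ} (hζ : 1 < ζ) {T : ℝ} (hT : 0 < T) {C : ℝ} (hC : 0 ≤ C) {α : ℝ} (hα : 0 < α)
    {D : Set.Icc (0 : ℝ) T → Ω → ℝ} (hD : ∀ t, IsSubPhi P (powPhi ζ) (D t))
    (hinc : IncrementBound P (powPhi ζ) D (fun h => C * h ^ α))
    {β : ℝ} (hβ : C * (T / 2) ^ α ≤ β) {γ : ℝ}
    (hγ : ∀ t, γ ∈ subPhiBounds P (powPhi ζ) (D t)) {p : ℝ} (hp0 : 0 < p) (hp1 : p < 1)
    {l : ℝ} (hl : 0 ≤ l) :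
    ∃ H : Ω → ENNReal, Measurable H ∧ ∫⁻ ω, H ω ∂P ≤ 1 ∧
      ∀ t, ∀ᵐ ω ∂P, ENNReal.ofReal (Real.exp (l * |D t ω| -
        (Real.log 4 + -Real.log p / α / (1 - p) +
          ((1 - p) * powPhi ζ (γ * l / (1 - p)) + p * powPhi ζ (β * l / (1 - p)))))) ≤ H ω := by
  set κ := -Real.log p / α with hκ
  have hκ0 : 0 ≤ κ := div_nonneg (neg_nonneg.2 (Real.log_nonpos hp0.le hp1.le)) hα.le
  have hq : 0 < 1 - p := sub_pos.2 hp1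
  have hβ0 : 0 ≤ β := le_trans (by positivity) hβ
  -- With `κ = -log p / α`, this size makes `σ` of the mesh at most `β p^(j+1)`.
  set M : ℕ → ℕ := fun j => ⌈Real.exp ((j + 1) * κ)⌉₊ with hM
  have hMpos : ∀ j, 0 < M j := fun j => Nat.ceil_pos.2 (Real.exp_pos _)
  have hMle : ∀ j : ℕ, Real.exp ((j + 1) * κ) ≤ M j := fun j => Nat.le_ceil _
  have hMlt : ∀ j : ℕ, (M j : ℝ) ≤ 2 * Real.exp ((j + 1) * κ) := by
    intro j
    have h1 := (Nat.ceil_lt_add_one (Real.exp_pos ((j + 1) * κ)).le).le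
    have h2 : 1 ≤ Real.exp ((j + 1) * κ) := Real.one_le_exp (by positivity)
    linarith
  choose v π hvπ using fun j => exists_net_Icc hT (hMpos j)
  set c : ℕ → ℝ := fun j => if j = 0 then γ else β * p ^ j with hc
  have hcs : Summable c := by
    rw [← summable_nat_add_iff 1]
    simpa [hc] using ((summable_nat_add_iff 1).2
      (summable_geometric_of_lt_one hp0.le hp1)).mul_left β
  have hstep : ∀ j t, c (j + 1) ∈
      subPhiBounds P (powPhi ζ) (fun ω => D t ω - D (v j (π j t)) ω) := by
    intro j t
    set r := T / 2 * Real.exp (-((j + 1) * κ)) with hr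
    have hr0 : 0 < r := by positivity
    have hdist : dist t (v j (π j t)) ≤ r := by
      refine (hvπ j t).2.trans ?_
      rw [hr, Real.exp_neg, ← div_eq_mul_inv, div_div]
      gcongr
      exact hMle j
    refine mem_subPhiBounds_mono hζ (hinc.mem_subPhiBounds hζ hD hr0 hdist) ?_
    have he : Real.exp (-((j + 1) * κ)) ^ α = p ^ (j + 1) := by
      rw [← Real.exp_mul, hκ]
      have : -((j + 1) * (-Real.log p / α)) * α = ((j + 1 : ℕ) : ℝ) * Real.log p := by
        push_cast
        field_simp
      rw [this, Real.exp_nat_mul, Real.exp_log hp0]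
    simp only [hc, Nat.succ_ne_zero, if_false]
    rw [hr, Real.mul_rpow (by positivity) (by positivity), he, ← mul_assoc]
    gcongr
  have hw1 : HasSum (fun j : ℕ => p ^ j * (1 - p)) 1 := by
    have := (hasSum_geometric_of_lt_one hp0.le hp1).mul_right (1 - p)
    rwa [inv_mul_cancel₀ hq.ne'] at this
  have hΦ0 : ∀ x, 0 ≤ powPhi ζ x := fun x =>
    div_nonneg (Real.rpow_nonneg (abs_nonneg _) _) (by linarith)
  refine exists_majorant_of_nets hζ (fun t => (hD t).1) v (M := M) (π := π)
    (fun j t => (hvπ j t).1) hcs (fun i => by simpa [hc] using hγ _) hstep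
    (w := fun j => p ^ j * (1 - p))
    -- Of the factor `4`, one `2` pays for the rounding in `M j` and the other for the two signs in
    -- `|·|`.
    (L := fun j => Real.log 4 + (j + 1) * κ +
      if j = 0 then powPhi ζ (γ * l / (1 - p)) else powPhi ζ (β * l / (1 - p)))
    (fun j => by positivity) hw1 hl (fun j => ?_)
    (fun n => sum_chaining_weights_le hp0 hp1 (Real.log_nonneg (by norm_num)) hκ0
      (hΦ0 _) (hΦ0 _) n)
  have harg : powPhi ζ (c j * (l / (p ^ j * (1 - p)))) =
      if j = 0 then powPhi ζ (γ * l / (1 - p)) else powPhi ζ (β * l / (1 - p)) := by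
    rcases eq_or_ne j 0 with rfl | hj
    · simp [hc, mul_div_assoc]
    · simp only [hc, if_neg hj]
      congr 1
      field_simp
  rw [harg, Real.exp_add, Real.exp_add, Real.exp_log (by norm_num : (0 : ℝ) < 4)]
  nlinarith [mul_le_mul_of_nonneg_right (hMlt j) (Real.exp_pos
    (if j = 0 then powPhi ζ (γ * l / (1 - p)) else powPhi ζ (β * l / (1 - p)))).le]

/-! ### Tail bound and conclusion -/

theorem measureReal_lt_iSup_le_of_majorant {Ω : Type*} [MeasurableSpace Ω] {P : Measure Ω}
    {B : Type*} {D : B → Ω → ℝ} {S : Set B} (hS : S.Countable)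
    (hSD : ∀ᵐ ω ∂P, ∀ F : Set ℝ, IsClosed F → (∀ s ∈ S, D s ω ∈ F) → ∀ t, D t ω ∈ F)
    {H : Ω → ENNReal} (hH : Measurable H) (hH1 : ∫⁻ ω, H ω ∂P ≤ 1) {l A : ℝ} (hl : 0 ≤ l)
    (hHD : ∀ t, ∀ᵐ ω ∂P, ENNReal.ofReal (Real.exp (l * |D t ω| - A)) ≤ H ω) (δ : ℝ) :
    P.real {ω | ENNReal.ofReal δ < ⨆ t : B, ENNReal.ofReal |D t ω|} ≤
      Real.exp (A - l * δ) := by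
  have hae : ∀ᵐ ω ∂P, ω ∈ {ω | ENNReal.ofReal δ < ⨆ t : B, ENNReal.ofReal |D t ω|} →
      ω ∈ {ω | ENNReal.ofReal (Real.exp (l * δ - A)) ≤ H ω} := by
    filter_upwards [hSD, (ae_ball_iff hS).2 fun s _ => hHD s] with ω h1 h2 hω
    obtain ⟨t, ht⟩ := lt_iSup_iff.1 hω
    -- The closed set depends on `ω` through `H ω`, so the separability hypothesis must handle all
    -- closed sets off one null set.
    have hF : IsClosed {x : ℝ | ENNReal.ofReal (Real.exp (l * |x| - A)) ≤ H ω} :=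
      isClosed_le (ENNReal.continuous_ofReal.comp
        (by fun_prop : Continuous fun x : ℝ => Real.exp (l * |x| - A))) continuous_const
    refine le_trans (ENNReal.ofReal_le_ofReal (Real.exp_le_exp.2 ?_)) (h1 _ hF h2 t)
    have : δ < |D t ω| := (ENNReal.ofReal_lt_ofReal_iff'.1 ht).1
    gcongr
  have hle : P {ω | ENNReal.ofReal δ < ⨆ t : B, ENNReal.ofReal |D t ω|} ≤
      ENNReal.ofReal (Real.exp (A - l * δ)) := by
    refine (measure_mono_ae hae).trans ?_
    refine (meas_ge_le_lintegral_div hH.aemeasurable ?_ ENNReal.ofReal_ne_top).trans ?_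
    · simpa using Real.exp_pos _
    · refine (ENNReal.div_le_div_right hH1 _).trans (le_of_eq ?_)
      rw [one_div, ← ENNReal.ofReal_inv_of_pos (Real.exp_pos _), ← Real.exp_neg, neg_sub]
  exact ENNReal.toReal_le_of_le_ofReal (Real.exp_pos _).le hle

theorem theorem8 {Ω : Type*} [MeasurableSpace Ω] (P : Measure Ω) [IsProbabilityMeasure P]
    (ζ : ℝ) (hζ1 : 1 < ζ) (hζ2 : ζ ≤ 2)
    (T : ℝ) (hT : 0 < T)
    (C : ℝ) (hC : 0 ≤ C) (α : ℝ) (hα0 : 0 < α) (hα1 : α < 1)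
    (X : Set.Icc (0 : ℝ) T → Ω → ℝ)
    (hX : ∀ t, IsSubPhi P (powPhi ζ) (X t))
    (hsep : IsSeparablePaths P X)
    (hinc : IncrementBound P (powPhi ζ) X (fun h => C * h ^ α))
    (ξ : ℕ → Ω → ℝ) (a : ℕ → Set.Icc (0 : ℝ) T → ℝ)
    (hξ : ∀ k, IsSubPhi P (powPhi ζ) (ξ k))
    (hseries : IsSeries P X ξ a)
    (N : ℕ)
    (hN : iIndepFun ξ P ∨
      IncrementBound P (powPhi ζ) (modelError X (seriesModel ξ a N)) (fun h => C * h ^ α))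
    (β : ℝ) (hβ : β = radiusBeta (Set.Icc (0 : ℝ) T) (fun h => C * h ^ α))
    (γ : ℝ) (hγ : γ = supStd P (powPhi ζ) (modelError X (seriesModel ξ a N)))
    (hγ0 : 0 < γ) (δ : ℝ) (hδ : γ < δ) (ν : ℝ)
    (hν : 2 * Real.exp (-((ζ - 1) * δ ^ (1 / (ζ - 1)) * (δ - γ) ^ (ζ / (ζ - 1)) /
        (ζ * (γ ^ ζ * (δ - γ) + β ^ ζ * γ) ^ (1 / (ζ - 1))))) *
        (2 * (Real.exp 1 * δ / γ) ^ (1 / α)) ≤ ν) :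
    ApproximatesUniformly P X (seriesModel ξ a N) ν δ := by
  have hD : ∀ t, IsSubPhi P (powPhi ζ) (modelError X (seriesModel ξ a N) t) :=
    fun t => (hX t).sub hζ1 (isSubPhi_seriesModel hζ1 hξ N t)
  have hΔ : IncrementBound P (powPhi ζ) (modelError X (seriesModel ξ a N))
      (fun h => C * h ^ α) :=
    hN.elim (fun hind => hinc.modelError_of_iIndepFun hζ1 hX hξ hseries hind N) id
  have hβ' : C * (T / 2) ^ α ≤ β := hβ ▸ le_radiusBeta_Icc hT hC hα0
  have hβ0 : 0 ≤ β := le_trans (by positivity) hβ'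
  -- An unbounded real supremum has default value `0`, which `0 < γ` excludes.
  have hbdd : BddAbove (Set.range fun t =>
      subPhiStd P (powPhi ζ) (modelError X (seriesModel ξ a N) t)) := by
    by_contra h
    rw [hγ, supStd, Real.iSup_of_not_bddAbove h] at hγ0
    exact lt_irrefl _ hγ0
  have hγmem : ∀ t, γ ∈ subPhiBounds P (powPhi ζ) (modelError X (seriesModel ξ a N) t) :=
    fun t => mem_subPhiBounds_of_subPhiStd_le hζ1 (hD t).2 (hγ ▸ le_ciSup hbdd t)
  have hδ0 : 0 < δ := hγ0.trans hδ
  have hp0 : 0 < γ / δ := div_pos hγ0 hδ0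
  have hp1 : γ / δ < 1 := (div_lt_one hδ0).2 hδ
  obtain ⟨l, hl, hle⟩ := exists_chernoff_parameter hζ1 hγ0 hδ hβ0
  obtain ⟨S, hS, hSD⟩ := exists_ae_forall_modelError_mem hζ1 hα0 hX hsep hinc hξ hΔ
  obtain ⟨H, hHm, hH1, hH⟩ := exists_majorant_Icc hζ1 hT hC hα0 hD hΔ hβ' hγmem hp0 hp1 hl
  refine (measureReal_lt_iSup_le_of_majorant hS hSD hHm hH1 hl hH δ).trans (le_trans ?_ hν)
  have hent : -Real.log (γ / δ) / α / (1 - γ / δ) ≤ (1 - Real.log (γ / δ)) * (1 / α) := by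
    rw [div_right_comm, div_eq_mul_one_div _ α]
    gcongr
    exact neg_log_div_one_sub_le hp0 hp1
  have hfac : (Real.exp 1 * δ / γ) ^ (1 / α) =
      Real.exp ((1 - Real.log (γ / δ)) * (1 / α)) := by
    rw [Real.exp_mul, Real.exp_sub, Real.exp_log hp0, div_div_eq_mul_div]
  rw [hfac, ← hle]
  calc _ ≤ Real.exp (Real.log 4 + (1 - Real.log (γ / δ)) * (1 / α) +
        ((1 - γ / δ) * powPhi ζ (γ * l / (1 - γ / δ)) +
          γ / δ * powPhi ζ (β * l / (1 - γ / δ)) - l * δ)) := by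
        refine Real.exp_le_exp.2 ?_
        linarith
    _ = _ := by
        rw [Real.exp_add, Real.exp_add, Real.exp_log (by norm_num : (0 : ℝ) < 4)]
        ring
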